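/- All graphs are finite, simple and connected. For a graph $G$ let $d_G(u,v)$ be the distance between vertices $u,v$, and let $n_G(u,v)$ be the number of vertices $w$ with $d_G(w,u)<d_G(w,v)$. The Wiener index and the Szeged index of $G$ are $$W(G)=\sum_{\{u,v\}\subseteq V(G)} d_G(u,v),\qquad \mathrm{Sz}(G)=\sum_{\{s,t\}\in E(G)} n_G(s,t)\,n_G(t,s),$$ where the first sum is over unordered pairs of vertices. A cactus graph is a connected graph in which any two distinct cycles have at most one common vertex. A block of $G$ is a maximal subgraph among the connected subgraphs of $G$ that have at least two vertices and no cut vertex of their own (so a single edge can be a block, and a graph with only one vertex has no blocks). Theorem. For every cactus graph $G$, $$\mathrm{Sz}(G)\le 2\,W(G),$$ with equality if and only if every block of $G$ is a cycle of even length. -/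

import Mathlib

namespace SimpleGraph

variable {V : Type*} {G : SimpleGraph V}

/-- The subgraph `H` of `G` is a cycle of length `n` (automatically `3 ≤ n`). -/
def Subgraph.IsCycleOfLength (H : G.Subgraph) (n : ℕ) : Prop :=
  ∃ (u : V) (p : G.Walk u u), p.IsCycle ∧ p.length = n ∧ p.toSubgraph = H

/-- The subgraph `H` of `G` is a cycle. -/
def Subgraph.IsCycle (H : G.Subgraph) : Prop :=
  ∃ n : ℕ, H.IsCycleOfLength n

/-- The subgraph `H` of `G` is a cycle of even length. -/
def Subgraph.IsEvenCycle (H : G.Subgraph) : Prop :=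
  ∃ n : ℕ, Even n ∧ H.IsCycleOfLength n

/-- `H` is connected, has at least two vertices, and has no cut vertex: it stays connected when
any one of its vertices is deleted. A single edge with its two ends counts, a single vertex
does not. -/
structure Subgraph.IsTwoConnected (H : G.Subgraph) : Prop where
  connected : H.Connected
  nontrivial : H.verts.Nontrivial
  no_cut_vertex : ∀ v ∈ H.verts, (H.deleteVerts {v}).Connected

/-- A block of `G` is a maximal two-connected subgraph (single edges being allowed). -/
def Subgraph.IsBlock (H : G.Subgraph) : Prop :=
  Maximal (fun K : G.Subgraph => K.IsTwoConnected) H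

variable (G)

/-- A cactus is a connected graph in which any two distinct cycles have at most one common
vertex. -/
structure IsCactus : Prop where
  connected : G.Connected
  cycles_inter : ∀ C D : G.Subgraph, C.IsCycle → D.IsCycle → C ≠ D →
    (C.verts ∩ D.verts).Subsingleton

/-- The Wiener index: the sum of the distances over all unordered pairs of vertices (a pair on
the diagonal contributes `0`). -/
noncomputable def wienerIndex [Fintype V] [DecidableEq V] : ℕ :=
  ∑ e : Sym2 V, Sym2.lift ⟨fun u v => G.dist u v, fun _ _ => G.dist_comm⟩ e

/-- The number of vertices that are closer to `u` than to `v`. -/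
noncomputable def numCloser [Fintype V] (u v : V) : ℕ :=
  (Finset.univ.filter fun w : V => G.dist w u < G.dist w v).card

/-- The Szeged index: the sum of `numCloser s t * numCloser t s` over all edges `s(s, t)`. -/
noncomputable def szegedIndex [Fintype V] [Fintype G.edgeSet] : ℕ :=
  ∑ e ∈ G.edgeFinset,
    Sym2.lift ⟨fun s t => G.numCloser s t * G.numCloser t s, fun _ _ => mul_comm _ _⟩ e

end SimpleGraph

/-! Double counting: `2 * Sz` sums, over ordered pairs `(u, v)`, the number of darts `(s, t)` with
`u` nearer to `s` and `v` nearer to `t`, while `2 * W` sums `dist u v`. So it suffices to compare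
pair by pair: at most `2 * dist u v` darts separate `u` from `v` (`card_separatingPairs_le`).

For an edge `xy` of a cactus, an edge other than `xy` leaving the half-space of `x` closes a cycle
through `xy`. Two such cycles coincide, so at most two edges leave (`boundary_unique`). Summing this
along a geodesic gives the bound.

Equality for adjacent vertices forces each edge onto an even cycle. Conversely, even cycles exclude
ties in distance to the ends of an edge, and the counts are then superadditive along geodesics
(`card_separatingPairs_add_le`). Finally, in a cactus a block that shares an edge with a cycle is
that cycle. -/

namespace SimpleGraph

/-! ### Double counting of both indices -/

section Counting

open Classical in
lemma sum_adj_pairs_eq_two_mul_sum_edgeFinset {V : Type*} [Fintype V] [DecidableEq V]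
    (G : SimpleGraph V) [Fintype G.edgeSet] (f : Sym2 V → ℕ) :
    ∑ p : V × V with G.Adj p.1 p.2, f s(p.1, p.2) = 2 * ∑ e ∈ G.edgeFinset, f e := by
  rw [← Finset.sum_fiberwise_of_maps_to (t := G.edgeFinset)
    (g := fun p : V × V => s(p.1, p.2)) (by simp), Finset.mul_sum]
  refine Finset.sum_congr rfl fun e he => ?_
  induction e using Sym2.ind with
  | _ a b =>
    have hab : G.Adj a b := by simpa using he
    have : (Finset.univ.filter fun p : V × V => G.Adj p.1 p.2).filter
        (fun p => s(p.1, p.2) = s(a, b)) = {(a, b), (b, a)} := by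
      ext ⟨c, d⟩
      simp only [Finset.mem_filter, Finset.mem_univ, true_and, Sym2.eq_iff, Finset.mem_insert,
        Finset.mem_singleton, Prod.mk.injEq]
      constructor
      · exact fun h => h.2
      · rintro (⟨rfl, rfl⟩ | ⟨rfl, rfl⟩)
        · exact ⟨hab, by simp⟩
        · exact ⟨hab.symm, by simp⟩
    rw [this, Finset.sum_pair (by simp [hab.ne])]
    simp only [Sym2.eq_swap (a := b) (b := a)]
    ring

open Classical in
/-- The ordered pairs `(s, t)` of adjacent vertices such that `u` is closer to `s` and `v` is
closer to `t`. -/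
noncomputable def separatingPairs {V : Type*} [Fintype V] (G : SimpleGraph V) (u v : V) :
    Finset (V × V) :=
  {p : V × V | G.Adj p.1 p.2 ∧ G.dist u p.1 < G.dist u p.2 ∧ G.dist v p.2 < G.dist v p.1}

lemma mem_separatingPairs {V : Type*} [Fintype V] {G : SimpleGraph V} {u v : V} {p : V × V} :
    p ∈ G.separatingPairs u v ↔
      G.Adj p.1 p.2 ∧ G.dist u p.1 < G.dist u p.2 ∧ G.dist v p.2 < G.dist v p.1 := by
  simp [separatingPairs]

open Classical in
lemma two_mul_szegedIndex {V : Type*} [Fintype V] [DecidableEq V] (G : SimpleGraph V)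
    [Fintype G.edgeSet] :
    2 * G.szegedIndex = ∑ q : V × V, (G.separatingPairs q.1 q.2).card := by
  rw [szegedIndex, ← sum_adj_pairs_eq_two_mul_sum_edgeFinset]
  have h : ∀ p : V × V, G.numCloser p.1 p.2 * G.numCloser p.2 p.1 =
      (Finset.univ.filter fun q : V × V =>
        G.dist q.1 p.1 < G.dist q.1 p.2 ∧ G.dist q.2 p.2 < G.dist q.2 p.1).card := by
    intro p
    rw [numCloser, numCloser, ← Finset.card_product]
    congr 1
    ext q
    simp
  simp only [Sym2.lift_mk, h, separatingPairs, Finset.card_filter]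
  rw [Finset.sum_comm, Finset.sum_congr rfl]
  intro q _
  rw [Finset.sum_filter]
  refine Finset.sum_congr rfl fun p _ => ?_
  by_cases hp : G.Adj p.1 p.2 <;> simp [hp]

open Classical in
lemma two_mul_wienerIndex {V : Type*} [Fintype V] [DecidableEq V] (G : SimpleGraph V) :
    2 * G.wienerIndex = ∑ q : V × V, G.dist q.1 q.2 := by
  have h := sum_adj_pairs_eq_two_mul_sum_edgeFinset (⊤ : SimpleGraph V)
    (Sym2.lift ⟨fun u v => G.dist u v, fun _ _ => G.dist_comm⟩)
  rw [wienerIndex, ← Finset.sum_subset (Finset.subset_univ (⊤ : SimpleGraph V).edgeFinset), ← h]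
  · rw [Finset.sum_filter]
    refine Finset.sum_congr rfl fun p _ => ?_
    by_cases hp : p.1 = p.2 <;> simp [hp]
  · intro e _ he
    induction e using Sym2.ind with
    | _ a b =>
      have : a = b := by simpa using he
      simp [this]

end Counting

/-! ### Edges leaving a half-space, and the cycles they close -/

section Cycles

variable {V : Type*} {G : SimpleGraph V}

lemma Connected.dist_le_dist_add_one (hG : G.Connected) {x y : V} (h : G.Adj x y) (w : V) :
    G.dist w x ≤ G.dist w y + 1 := by
  have := hG.dist_triangle (u := w) (v := y) (w := x)
  rwa [dist_eq_one_iff_adj.2 h.symm] at this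

lemma Walk.dist_add_dist_of_mem_support (hG : G.Connected) {u v w : V} {p : G.Walk u v}
    (hp : p.length = G.dist u v) (hw : w ∈ p.support) :
    G.dist u w + G.dist w v = G.dist u v := by
  classical
  refine le_antisymm ?_ hG.dist_triangle
  rw [← hp, ← p.take_spec hw, Walk.length_append]
  exact add_le_add (dist_le _) (dist_le _)

lemma dist_lt_of_mem_support (hG : G.Connected) {x y s w : V} {p : G.Walk x s}
    (hp : p.length = G.dist x s) (hw : w ∈ p.support) (hs : G.dist s x < G.dist s y) :
    G.dist w x < G.dist w y := by
  have h1 := Walk.dist_add_dist_of_mem_support hG hp hw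
  have h2 := hG.dist_triangle (u := s) (v := w) (w := y)
  rw [G.dist_comm (u := s) (v := x)] at hs
  rw [G.dist_comm (u := s) (v := w)] at h2
  rw [G.dist_comm (u := w) (v := x)]
  omega

lemma dist_le_of_mem_support (hG : G.Connected) {x y t w : V} {p : G.Walk t y}
    (hp : p.length = G.dist t y) (hw : w ∈ p.support) (ht : G.dist t y ≤ G.dist t x) :
    G.dist w y ≤ G.dist w x := by
  have h1 := Walk.dist_add_dist_of_mem_support hG hp hw
  have h2 := hG.dist_triangle (u := t) (v := w) (w := x)
  omega

/-- Two edges leaving the set of the vertices closer to `x` than to `y`, one of which is `xy`,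
lie on a common cycle that leaves this set only there. -/
lemma exists_isCycle_of_boundary (hG : G.Connected) {x y s t : V} (hxy : G.Adj x y)
    (hst : G.Adj s t) (hs : G.dist s x < G.dist s y) (ht : G.dist t y ≤ G.dist t x)
    (hne : (s, t) ≠ (x, y)) :
    ∃ c : G.Walk y y, c.IsCycle ∧ c.length = G.dist x s + G.dist t y + 2 ∧
      s(x, y) ∈ c.edges ∧ s(s, t) ∈ c.edges ∧
      ∀ a b, s(a, b) ∈ c.edges → G.dist a x < G.dist a y → G.dist b y ≤ G.dist b x →
        (a, b) = (x, y) ∨ (a, b) = (s, t) := by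
  obtain ⟨p, hp, hpl⟩ := hG.exists_path_of_dist x s
  obtain ⟨q, hq, hql⟩ := hG.exists_path_of_dist t y
  have hpA : ∀ w ∈ p.support, G.dist w x < G.dist w y := fun w hw =>
    dist_lt_of_mem_support hG hpl hw hs
  have hqA : ∀ w ∈ q.support, G.dist w y ≤ G.dist w x := fun w hw =>
    dist_le_of_mem_support hG hql hw ht
  have hx : G.dist x x < G.dist x y := hpA x p.start_mem_support
  have hy : G.dist y y ≤ G.dist y x := hqA y q.end_mem_support
  -- The geodesics `p` and `q` stay on opposite sides of the half-space, hence are disjoint; `s(s,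
  -- t)` joins them and `xy` closes the cycle.
  have hpath : (p.append (Walk.cons hst q)).IsPath := by
    rw [Walk.isPath_def, Walk.support_append, Walk.support_cons, List.tail_cons,
      List.nodup_append]
    refine ⟨hp.support_nodup, hq.support_nodup, ?_⟩
    rintro a ha b hb rfl
    exact (hpA a ha).not_ge (hqA a hb)
  refine ⟨Walk.cons hxy.symm (p.append (Walk.cons hst q)), ?_, ?_, ?_, ?_, ?_⟩
  · rw [Walk.cons_isCycle_iff]
    refine ⟨hpath, ?_⟩
    simp only [Walk.edges_append, Walk.edges_cons, List.mem_append, List.mem_cons, Sym2.eq_iff]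
    rintro (h | (⟨rfl, rfl⟩ | ⟨rfl, rfl⟩) | h)
    · exact (hpA y (p.fst_mem_support_of_mem_edges h)).not_ge hy
    · exact hs.not_ge hy
    · exact hne rfl
    · exact hx.not_ge (hqA x (q.snd_mem_support_of_mem_edges h))
  · simp only [Walk.length_cons, Walk.length_append, hpl, hql]
    omega
  · simp [Sym2.eq_swap]
  · simp
  · intro a b hab ha hb
    simp only [Walk.edges_append, Walk.edges_cons, List.mem_append, List.mem_cons,
      Sym2.eq_iff] at hab
    rcases hab with (⟨rfl, rfl⟩ | ⟨rfl, rfl⟩) | hab | (⟨rfl, rfl⟩ | ⟨rfl, rfl⟩) | hab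
    · exact absurd hy ha.not_ge
    · exact Or.inl rfl
    · exact absurd hb (hpA b (p.snd_mem_support_of_mem_edges hab)).not_ge
    · exact Or.inr rfl
    · exact absurd ht ha.not_ge
    · exact absurd (hqA a (q.fst_mem_support_of_mem_edges hab)) ha.not_ge

lemma IsCactus.toSubgraph_eq (hG : G.IsCactus) {x y u v : V} (hxy : x ≠ y)
    {c : G.Walk u u} {d : G.Walk v v} (hc : c.IsCycle) (hd : d.IsCycle)
    (hcx : s(x, y) ∈ c.edges) (hdx : s(x, y) ∈ d.edges) : c.toSubgraph = d.toSubgraph := by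
  by_contra hne
  refine hxy (hG.cycles_inter _ _ ⟨_, u, c, hc, rfl, rfl⟩ ⟨_, v, d, hd, rfl, rfl⟩ hne ?_ ?_)
  · simp [c.fst_mem_support_of_mem_edges hcx, d.fst_mem_support_of_mem_edges hdx]
  · simp [c.snd_mem_support_of_mem_edges hcx, d.snd_mem_support_of_mem_edges hdx]

lemma Walk.IsTrail.length_eq_of_toSubgraph_eq {u v u' v' : V} {c : G.Walk u v} {d : G.Walk u' v'}
    (hc : c.IsTrail) (hd : d.IsTrail) (h : c.toSubgraph = d.toSubgraph) :
    c.length = d.length := by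
  rw [← c.length_edges, ← d.length_edges]
  refine (List.Perm.length_eq ?_)
  rw [List.perm_ext_iff_of_nodup hc.edges_nodup hd.edges_nodup]
  intro e
  rw [← Walk.mem_edges_toSubgraph, h, Walk.mem_edges_toSubgraph]

/-- At most one edge besides `xy` leaves the set of the vertices closer to `x` than to `y`. -/
lemma IsCactus.boundary_unique (hG : G.IsCactus) {x y s t s' t' : V} (hxy : G.Adj x y)
    (hst : G.Adj s t) (hs : G.dist s x < G.dist s y) (ht : G.dist t y ≤ G.dist t x)
    (hst' : G.Adj s' t') (hs' : G.dist s' x < G.dist s' y) (ht' : G.dist t' y ≤ G.dist t' x)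
    (hne : (s, t) ≠ (x, y)) (hne' : (s', t') ≠ (x, y)) : (s', t') = (s, t) := by
  obtain ⟨c, hc, -, hcx, hcs, hcu⟩ :=
    exists_isCycle_of_boundary hG.connected hxy hst hs ht hne
  obtain ⟨d, hd, -, hdx, hds, -⟩ :=
    exists_isCycle_of_boundary hG.connected hxy hst' hs' ht' hne'
  have h := hG.toSubgraph_eq hxy.ne hc hd hcx hdx
  rw [← Walk.mem_edges_toSubgraph, ← h, Walk.mem_edges_toSubgraph] at hds
  exact (hcu s' t' hds hs' ht').resolve_left hne'

lemma IsCactus.exists_boundary_subset_pair (hG : G.IsCactus) {x y : V} (hxy : G.Adj x y) :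
    ∃ q : V × V, ∀ s t, G.Adj s t → G.dist s x < G.dist s y → G.dist t y ≤ G.dist t x →
      (s, t) = (x, y) ∨ (s, t) = q := by
  by_cases h : ∃ s t, G.Adj s t ∧ G.dist s x < G.dist s y ∧ G.dist t y ≤ G.dist t x ∧
      (s, t) ≠ (x, y)
  · obtain ⟨s, t, hst, hs, ht, hne⟩ := h
    refine ⟨(s, t), fun s' t' hst' hs' ht' => or_iff_not_imp_left.2 fun hne' => ?_⟩
    exact hG.boundary_unique hxy hst hs ht hst' hs' ht' hne hne'
  · push Not at h
    exact ⟨(x, y), fun s t hst hs ht => Or.inl (h s t hst hs ht)⟩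

end Cycles

/-! ### The bound, by a potential that is additive along walks -/

section UpperBound

variable {V : Type*} {G : SimpleGraph V}

/-- The difference of the distances of `w` to the two ends of a pair of vertices. -/
noncomputable def distDiff (G : SimpleGraph V) (p : V × V) (w : V) : ℤ :=
  G.dist w p.1 - G.dist w p.2

variable [Fintype V]

open Classical in
/-- The total increase of `distDiff` from `u` to `v` over all darts. -/
noncomputable def totalIncrease (G : SimpleGraph V) (u v : V) : ℤ :=
  ∑ p : V × V with G.Adj p.1 p.2, max (G.distDiff p v - G.distDiff p u) 0

lemma totalIncrease_self (u : V) : G.totalIncrease u u = 0 := by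
  simp [totalIncrease]

lemma totalIncrease_triangle (u w v : V) :
    G.totalIncrease u v ≤ G.totalIncrease u w + G.totalIncrease w v := by
  simp only [totalIncrease]
  rw [← Finset.sum_add_distrib]
  refine Finset.sum_le_sum fun p _ => ?_
  omega

/-- On a separating dart `distDiff` passes from negative at `u` to positive at `v`, an increase of
at least 2. Unlike the count itself, `totalIncrease` obeys a triangle inequality in any graph, so
bounding it on edges is enough. -/
lemma two_mul_card_separatingPairs_le (u v : V) :
    2 * ((G.separatingPairs u v).card : ℤ) ≤ G.totalIncrease u v := by
  classical
  rw [mul_comm, ← nsmul_eq_mul, ← Finset.sum_const, totalIncrease]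
  refine (Finset.sum_le_sum fun p hp => ?_).trans
    (Finset.sum_le_sum_of_subset_of_nonneg (s := G.separatingPairs u v)
      (fun p hp => ?_) fun p _ _ => le_max_right _ _)
  · obtain ⟨-, h1, h2⟩ := mem_separatingPairs.1 hp
    simp only [distDiff]
    omega
  · simpa using (mem_separatingPairs.1 hp).1

open Classical in
lemma IsCactus.card_boundary_le (hG : G.IsCactus) {x y : V} (hxy : G.Adj x y) :
    (Finset.univ.filter fun p : V × V => G.Adj p.1 p.2 ∧ G.dist p.1 x < G.dist p.1 y ∧
      G.dist p.2 y ≤ G.dist p.2 x).card ≤ 2 := by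
  obtain ⟨q, hq⟩ := hG.exists_boundary_subset_pair hxy
  refine (Finset.card_le_card (t := {(x, y), q}) fun p hp => ?_).trans Finset.card_le_two
  simp only [Finset.mem_filter, Finset.mem_univ, true_and] at hp
  simpa using hq p.1 p.2 hp.1 hp.2.1 hp.2.2

lemma IsCactus.totalIncrease_le_of_adj (hG : G.IsCactus) {x y : V} (hxy : G.Adj x y) :
    G.totalIncrease x y ≤ 4 := by
  classical
  have h1 := hG.card_boundary_le hxy
  have h2 : (Finset.univ.filter fun p : V × V => G.Adj p.1 p.2 ∧ G.dist p.2 y < G.dist p.2 x ∧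
      G.dist p.1 x ≤ G.dist p.1 y).card ≤ 2 := by
    refine le_trans (le_of_eq ?_) (hG.card_boundary_le hxy.symm)
    refine Finset.card_bij' (fun p _ => p.swap) (fun p _ => p.swap) ?_ ?_ ?_ ?_ <;>
      simp +contextual [adj_comm]
  -- With `f w = dist w y - dist w x`, which lies in `{-1, 0, 1}`, the dart `(s, t)` contributes the
  -- positive part of `f s - f t`. This counts which of the two sets `f ≥ 1` and `f ≥ 0` the dart
  -- leaves; each set is left by at most two darts.
  have h : G.totalIncrease x y ≤
      ((Finset.univ.filter fun p : V × V => G.Adj p.1 p.2 ∧ G.dist p.1 x < G.dist p.1 y ∧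
        G.dist p.2 y ≤ G.dist p.2 x).card : ℤ) +
      ((Finset.univ.filter fun p : V × V => G.Adj p.1 p.2 ∧ G.dist p.2 y < G.dist p.2 x ∧
        G.dist p.1 x ≤ G.dist p.1 y).card : ℤ) := by
    rw [totalIncrease, Finset.card_filter, Finset.card_filter, Finset.sum_filter, Nat.cast_sum,
      Nat.cast_sum, ← Finset.sum_add_distrib]
    refine Finset.sum_le_sum fun p _ => ?_
    by_cases hp : G.Adj p.1 p.2
    · have a1 := hG.connected.dist_le_dist_add_one hxy p.1
      have a2 := hG.connected.dist_le_dist_add_one hxy.symm p.1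
      have a3 := hG.connected.dist_le_dist_add_one hxy p.2
      have a4 := hG.connected.dist_le_dist_add_one hxy.symm p.2
      simp only [hp, true_and, if_true, distDiff, G.dist_comm (u := x), G.dist_comm (u := y)]
      split_ifs <;> push_cast <;> omega
    · simp [hp]
  omega

lemma IsCactus.totalIncrease_le_length (hG : G.IsCactus) {u v : V} (p : G.Walk u v) :
    G.totalIncrease u v ≤ 4 * p.length := by
  induction p with
  | nil => simp [totalIncrease_self]
  | @cons u w v h p ih =>
    have h1 := G.totalIncrease_triangle u w v
    have h2 := hG.totalIncrease_le_of_adj h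
    rw [Walk.length_cons]
    push_cast
    omega

lemma IsCactus.card_separatingPairs_le (hG : G.IsCactus) (u v : V) :
    (G.separatingPairs u v).card ≤ 2 * G.dist u v := by
  obtain ⟨p, hp⟩ := hG.connected.exists_walk_length_eq_dist u v
  have h1 := G.two_mul_card_separatingPairs_le u v
  have h2 := hG.totalIncrease_le_length p
  omega

lemma IsCactus.szegedIndex_le [DecidableEq V] [Fintype G.edgeSet] (hG : G.IsCactus) :
    G.szegedIndex ≤ 2 * G.wienerIndex := by
  have h := Finset.sum_le_sum fun (q : V × V) (_ : q ∈ Finset.univ) =>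
    hG.card_separatingPairs_le q.1 q.2
  rw [← two_mul_szegedIndex, ← Finset.mul_sum, ← two_mul_wienerIndex] at h
  omega

lemma IsCactus.szegedIndex_eq_iff [DecidableEq V] [Fintype G.edgeSet] (hG : G.IsCactus) :
    G.szegedIndex = 2 * G.wienerIndex ↔
      ∀ u v, (G.separatingPairs u v).card = 2 * G.dist u v := by
  have h := Finset.sum_eq_sum_iff_of_le fun (q : V × V) (_ : q ∈ Finset.univ) =>
    hG.card_separatingPairs_le q.1 q.2
  rw [← two_mul_szegedIndex, ← Finset.mul_sum, ← two_mul_wienerIndex] at h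
  simp only [Finset.mem_univ, true_imp_iff, Prod.forall] at h
  rw [← h]
  omega

end UpperBound

/-! ### Half-spaces when every edge lies on an even cycle -/

section EvenCycles

variable {V : Type*} {G : SimpleGraph V}

/-- Every edge lies on a cycle of even length. -/
def EdgesOnEvenCycles (G : SimpleGraph V) : Prop :=
  ∀ x y, G.Adj x y → ∃ (u : V) (c : G.Walk u u), c.IsCycle ∧ Even c.length ∧ s(x, y) ∈ c.edges

lemma edgesOnEvenCycles_of_card [Fintype V] (hG : G.Connected)
    (h : ∀ u v, (G.separatingPairs u v).card = 2 * G.dist u v) : G.EdgesOnEvenCycles := by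
  intro x y hxy
  have h2 := h x y
  rw [dist_eq_one_iff_adj.2 hxy] at h2
  obtain ⟨⟨s, t⟩, hst, hne⟩ := Finset.exists_mem_ne
    (by omega : 1 < (G.separatingPairs x y).card) (x, y)
  obtain ⟨hst, hs, ht⟩ := mem_separatingPairs.1 hst
  simp only at hst hs ht
  have a1 := hG.dist_le_dist_add_one hst x
  have a2 := hG.dist_le_dist_add_one hst y
  have a3 := hG.dist_le_dist_add_one hst.symm x
  have a4 := hG.dist_le_dist_add_one hst.symm y
  have b1 := hG.dist_le_dist_add_one hxy s
  have b2 := hG.dist_le_dist_add_one hxy.symm s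
  have b3 := hG.dist_le_dist_add_one hxy t
  have b4 := hG.dist_le_dist_add_one hxy.symm t
  simp only [G.dist_comm (u := s), G.dist_comm (u := t)] at b1 b2 b3 b4
  obtain ⟨c, hc, hl, hx, -⟩ := exists_isCycle_of_boundary hG hxy hst
    (by simp only [G.dist_comm (u := s)]; omega) (by simp only [G.dist_comm (u := t)]; omega) hne
  refine ⟨y, c, hc, ?_, hx⟩
  rw [hl, G.dist_comm (u := t)]
  -- Separation of `x` and `y` by `(s, t)` forces `dist x s = dist y t`.
  exact ⟨G.dist x s + 1, by omega⟩

/-- Move from a tied vertex along geodesics to `x`: the ties must end before distance 0, and the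
last tied vertex is `t`. -/
lemma exists_boundary_of_dist_eq (hG : G.Connected) {x y : V} (n : ℕ) :
    ∀ w, G.dist w x = n → G.dist w y = n → G.Adj x y →
      ∃ s t, G.Adj s t ∧ G.dist s x < G.dist s y ∧ G.dist t y = G.dist t x ∧
        G.dist t x = G.dist s x + 1 := by
  induction n with
  | zero =>
    intro w hx hy hxy
    exact absurd ((hG.dist_eq_zero_iff.1 hx).symm.trans (hG.dist_eq_zero_iff.1 hy)) hxy.ne
  | succ n ih =>
    intro w hx hy hxy
    obtain ⟨p, hp⟩ := hG.exists_walk_length_eq_dist w x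
    cases p with
    | nil => simp at hx
    | @cons _ v _ h p =>
      have h1 : G.dist v x ≤ p.length := dist_le p
      rw [Walk.length_cons] at hp
      have h2 := hG.dist_le_dist_add_one h x
      have h3 := hG.dist_le_dist_add_one h y
      simp only [G.dist_comm (u := x), G.dist_comm (u := y)] at h2 h3
      rcases (by omega : n = G.dist v y ∨ n < G.dist v y) with h4 | h4
      · exact ih v (by omega) h4.symm hxy
      · exact ⟨v, w, h.symm, by omega, by omega, by omega⟩

/-- An edge on an even cycle of a cactus has no vertex at equal distance from both ends. -/
lemma IsCactus.dist_ne_of_isCycle (hG : G.IsCactus) (hE : G.EdgesOnEvenCycles) {x y : V}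
    (hxy : G.Adj x y) (w : V) : G.dist w x ≠ G.dist w y := by
  intro hw
  obtain ⟨s, t, hst, hs, ht, hts⟩ :=
    exists_boundary_of_dist_eq hG.connected _ w rfl hw.symm hxy
  obtain ⟨c, hc, hl, hx, -⟩ := exists_isCycle_of_boundary hG.connected hxy hst hs ht.le
    (by rintro ⟨⟩; simp at ht; exact hxy.ne (hG.connected.dist_eq_zero_iff.1 ht.symm).symm)
  obtain ⟨u, d, hd, ⟨k, hk⟩, hdx⟩ := hE x y hxy
  have := Walk.IsTrail.length_eq_of_toSubgraph_eq hc.isTrail hd.isTrail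
    (hG.toSubgraph_eq hxy.ne hc hd hx hdx)
  -- The cycle closed at the tied vertex `t` has odd length `2 * dist s x + 3`, yet it equals the
  -- even cycle through `xy`.
  rw [hl, G.dist_comm (u := x), ht, hts] at this
  omega

lemma Walk.IsCycle.exists_path_of_mem_edges {u x y : V} {c : G.Walk u u} (hc : c.IsCycle)
    (h : s(x, y) ∈ c.edges) : ∃ p : G.Walk x y, s(x, y) ∉ p.edges := by
  have h1 : ¬ G.IsBridge s(x, y) := fun hb =>
    (isBridge_iff_forall_cycle_notMem (c.adj_of_mem_edges h)).1 hb c hc h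
  rw [isBridge_iff_forall_walk_mem_edges] at h1
  push Not at h1
  exact h1

lemma IsCactus.exists_separating_pair (hG : G.IsCactus) (hE : G.EdgesOnEvenCycles) {x y : V}
    (hxy : G.Adj x y) : ∃ s t, G.Adj s t ∧ G.dist x s < G.dist x t ∧ G.dist y t < G.dist y s ∧
      (s, t) ≠ (x, y) := by
  obtain ⟨u, c, hc, -, hx⟩ := hE x y hxy
  obtain ⟨p, hp⟩ := hc.exists_path_of_mem_edges hx
  have hd := dist_eq_one_iff_adj.2 hxy
  -- A walk from `x` to `y` avoiding the edge `xy` must leave the half-space of `x` through another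
  -- edge.
  obtain ⟨⟨⟨s, t⟩, hst⟩, hmem, hs, ht⟩ := p.exists_boundary_dart {w | G.dist w x < G.dist w y}
    (by simp [hd]) (by simp)
  simp only [Set.mem_ofPred_eq] at hs ht hst
  have hne := hG.dist_ne_of_isCycle hE hxy t
  have a1 := hG.connected.dist_le_dist_add_one hst x
  have a2 := hG.connected.dist_le_dist_add_one hst y
  have a3 := hG.connected.dist_le_dist_add_one hst.symm x
  have a4 := hG.connected.dist_le_dist_add_one hst.symm y
  have b1 := hG.connected.dist_le_dist_add_one hxy s
  have b2 := hG.connected.dist_le_dist_add_one hxy.symm s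
  have b3 := hG.connected.dist_le_dist_add_one hxy t
  have b4 := hG.connected.dist_le_dist_add_one hxy.symm t
  simp only [G.dist_comm (u := s), G.dist_comm (u := t)] at b1 b2 b3 b4 hs ht hne
  refine ⟨s, t, hst, by omega, by omega, ?_⟩
  rintro ⟨⟩
  exact hp (List.mem_map_of_mem (f := Dart.edge) hmem)

/-- If `(s, t)` separates adjacent `x` and `y`, then `(s, t)` and `(x, y)` induce the same
half-space. -/
lemma IsCactus.dist_lt_of_separating (hG : G.IsCactus) {x y s t w : V} (hxy : G.Adj x y)
    (hst : G.Adj s t) (hs : G.dist x s < G.dist x t) (ht : G.dist y t < G.dist y s)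
    (hw : G.dist w x < G.dist w y) : G.dist w s < G.dist w t := by
  by_cases hne : (s, t) = (x, y)
  · cases hne
    exact hw
  have a1 := hG.connected.dist_le_dist_add_one hst x
  have a2 := hG.connected.dist_le_dist_add_one hst y
  have a3 := hG.connected.dist_le_dist_add_one hst.symm x
  have a4 := hG.connected.dist_le_dist_add_one hst.symm y
  have b1 := hG.connected.dist_le_dist_add_one hxy s
  have b2 := hG.connected.dist_le_dist_add_one hxy.symm s
  have b3 := hG.connected.dist_le_dist_add_one hxy t
  have b4 := hG.connected.dist_le_dist_add_one hxy.symm t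
  simp only [G.dist_comm (u := s), G.dist_comm (u := t)] at b1 b2 b3 b4
  have hs' : G.dist s x < G.dist s y := by simp only [G.dist_comm (u := s)]; omega
  have ht' : G.dist t y < G.dist t x := by simp only [G.dist_comm (u := t)]; omega
  obtain ⟨p, hp⟩ := hG.connected.exists_walk_length_eq_dist w t
  -- A geodesic from `w` to `t` leaves the half-space by `(x, y)` or `(s, t)`. In the first case it
  -- passes `x`, which is nearer to `s` than to `t`; in the second it reaches `t` through `s`.
  obtain ⟨⟨⟨a, b⟩, hab⟩, hmem, ha, hb⟩ := p.exists_boundary_dart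
    {w | G.dist w x < G.dist w y} hw (by simpa using ht'.le)
  simp only [Set.mem_ofPred_eq, not_lt] at ha hb hab
  have hka := Walk.dist_add_dist_of_mem_support hG.connected hp
    (p.dart_fst_mem_support_of_mem_darts hmem)
  have hkb := Walk.dist_add_dist_of_mem_support hG.connected hp
    (p.dart_snd_mem_support_of_mem_darts hmem)
  simp only at hka hkb
  by_cases hab' : (a, b) = (x, y)
  · cases hab'
    have h1 := hG.connected.dist_triangle (u := w) (v := x) (w := s)
    omega
  · have := hG.boundary_unique hxy hst hs' ht'.le hab ha hb hne hab'
    cases this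
    rw [dist_eq_one_iff_adj.2 hst] at hka
    omega

end EvenCycles

/-! ### Superadditivity and the equality case -/

section Equality

variable {V : Type*} {G : SimpleGraph V}

/-- A dart separating `u` from `x` has the half-spaces of the edge `ux`, so `v`, lying on the side
of `x`, stays separated from `u`. A dart separating `x` from `v` cannot also separate `u` from `x`,
and without ties `u` is then on the side of `x`. -/
lemma IsCactus.card_separatingPairs_add_le [Fintype V] (hG : G.IsCactus)
    (hE : G.EdgesOnEvenCycles) {u x v : V} (hux : G.Adj u x) (hv : G.dist v x < G.dist v u) :
    (G.separatingPairs u x).card + (G.separatingPairs x v).card ≤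
      (G.separatingPairs u v).card := by
  classical
  rw [← Finset.card_union_of_disjoint]
  · refine Finset.card_le_card fun p hp => ?_
    rw [mem_separatingPairs]
    rcases Finset.mem_union.1 hp with hp | hp
    · obtain ⟨hst, h1, h2⟩ := mem_separatingPairs.1 hp
      exact ⟨hst, h1, hG.dist_lt_of_separating hux.symm hst.symm h2 h1 hv⟩
    · obtain ⟨hst, h1, h2⟩ := mem_separatingPairs.1 hp
      refine ⟨hst, ?_, h2⟩
      by_contra h3
      have h4 : G.dist u p.2 < G.dist u p.1 :=
        lt_of_le_of_ne (not_lt.1 h3) (hG.dist_ne_of_isCycle hE hst u).symm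
      exact (hG.dist_lt_of_separating hux.symm hst h1 h4 hv).not_gt h2
  · rw [Finset.disjoint_left]
    intro p hp hp'
    exact (mem_separatingPairs.1 hp).2.2.not_gt (mem_separatingPairs.1 hp').2.1

lemma IsCactus.two_mul_dist_le_card_separatingPairs [Fintype V] (hG : G.IsCactus)
    (hE : G.EdgesOnEvenCycles) (n : ℕ) :
    ∀ u v, G.dist u v = n → 2 * n ≤ (G.separatingPairs u v).card := by
  induction n with
  | zero => simp
  | succ n ih =>
    intro u v huv
    obtain ⟨p, hp⟩ := hG.connected.exists_walk_length_eq_dist u v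
    cases p with
    | nil => simp at huv
    | @cons _ x _ h p =>
      have h1 : G.dist x v ≤ p.length := dist_le p
      have h2 := hG.connected.dist_le_dist_add_one h v
      rw [Walk.length_cons] at hp
      rw [G.dist_comm (u := v), G.dist_comm (u := v)] at h2
      have h3 := ih x v (by omega)
      have h4 := hG.card_separatingPairs_add_le hE (v := v) h
        (by rw [G.dist_comm (u := v), G.dist_comm (u := v)]; omega)
      obtain ⟨s, t, hst, hs, ht, hne⟩ := hG.exists_separating_pair hE h
      have hd := dist_eq_one_iff_adj.2 h
      have h5 : 1 < (G.separatingPairs u x).card :=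
        Finset.one_lt_card.2 ⟨(s, t), mem_separatingPairs.2 ⟨hst, hs, ht⟩, (u, x),
          mem_separatingPairs.2 ⟨h, by simp [hd], by simp [G.dist_comm (u := x), hd]⟩, hne⟩
      omega

lemma IsCactus.szegedIndex_eq_iff_edgesOnEvenCycles [Fintype V] [DecidableEq V]
    [Fintype G.edgeSet] (hG : G.IsCactus) :
    G.szegedIndex = 2 * G.wienerIndex ↔ G.EdgesOnEvenCycles := by
  rw [hG.szegedIndex_eq_iff]
  refine ⟨edgesOnEvenCycles_of_card hG.connected, fun hE u v => ?_⟩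
  exact le_antisymm (hG.card_separatingPairs_le u v)
    (hG.two_mul_dist_le_card_separatingPairs hE _ u v rfl)

end Equality

/-! ### Blocks of a cactus and even cycles -/

section Blocks

variable {V : Type*} {G : SimpleGraph V}

lemma Subgraph.isTwoConnected_subgraphOfAdj {x y : V} (h : G.Adj x y) :
    (G.subgraphOfAdj h).IsTwoConnected := by
  refine ⟨subgraphOfAdj_connected h, ⟨x, by simp, y, by simp, h.ne⟩, fun v hv => ?_⟩
  rw [Subgraph.connected_iff]
  refine ⟨⟨?_⟩, ?_⟩
  · have : Subsingleton ((G.subgraphOfAdj h).deleteVerts {v}).verts := by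
      refine ⟨fun ⟨a, ha⟩ ⟨b, hb⟩ => ?_⟩
      simp only [Subgraph.deleteVerts_verts, subgraphOfAdj_verts, Set.mem_sdiff,
        Set.mem_insert_iff, Set.mem_singleton_iff] at ha hb hv
      rw [Subtype.mk.injEq]
      grind
    exact Preconnected.of_subsingleton
  · simp only [subgraphOfAdj_verts, Set.mem_insert_iff, Set.mem_singleton_iff] at hv
    rcases hv with rfl | rfl
    · exact ⟨y, by simp [h.ne.symm]⟩
    · exact ⟨x, by simp [h.ne]⟩

lemma Walk.IsCycle.connected_deleteVerts {v : V} {c : G.Walk v v} (hc : c.IsCycle) :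
    (c.toSubgraph.deleteVerts {v}).Connected := by
  cases c with
  | nil => exact absurd hc (by simp)
  | @cons _ w _ h q =>
    obtain ⟨hq, -⟩ := (Walk.cons_isCycle_iff q h).1 hc
    have hnil : ¬ q.Nil := fun hn => h.ne hn.eq.symm
    have hsup : q.support = q.dropLast.support ++ [v] := by
      rw [Walk.support_dropLast hnil]
      conv_lhs => rw [← List.dropLast_append_getLast q.support_ne_nil]
      simp
    have hv : v ∉ q.dropLast.support := by
      have := hq.support_nodup
      rw [hsup, List.nodup_append] at this
      exact fun hm => this.2.2 v hm v (by simp) rfl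
    -- Deleting the base point of the cycle leaves the path `q.dropLast`, which is connected.
    refine q.dropLast.toSubgraph_connected.mono' (fun a b hab => ?_) ?_
    · have ha := q.dropLast.toSubgraph.edge_vert hab
      have hb := q.dropLast.toSubgraph.edge_vert hab.symm
      rw [Walk.mem_verts_toSubgraph] at ha hb
      have hab' : q.toSubgraph.Adj a b := by
        rw [← Subgraph.mem_edgeSet, Walk.mem_edges_toSubgraph] at hab ⊢
        exact (q.isSubwalk_take _).edges_subset hab
      have hC : (Walk.cons h q).toSubgraph.Adj a b := by
        rw [Walk.toSubgraph, Subgraph.sup_adj]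
        exact Or.inr hab'
      rw [Subgraph.deleteVerts_adj]
      exact ⟨(Walk.cons h q).toSubgraph.edge_vert hC, fun h => hv (h ▸ ha),
        (Walk.cons h q).toSubgraph.edge_vert hC.symm, fun h => hv (h ▸ hb), hC⟩
    · ext a
      simp only [Walk.mem_verts_toSubgraph, Subgraph.deleteVerts_verts, Set.mem_sdiff,
        Walk.support_cons, hsup, Set.mem_singleton_iff, List.mem_cons, List.mem_append,
        List.not_mem_nil, or_false]
      constructor
      · exact fun ha => ⟨Or.inr (Or.inl ha), fun h => hv (h ▸ ha)⟩
      · tauto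

lemma Walk.IsCycle.isTwoConnected {u : V} {c : G.Walk u u} (hc : c.IsCycle) :
    c.toSubgraph.IsTwoConnected := by
  classical
  refine ⟨c.toSubgraph_connected, ?_, fun v hv => ?_⟩
  · refine ⟨u, by simp, c.snd, by simp, (c.adj_snd hc.not_nil).ne⟩
  · rw [Walk.mem_verts_toSubgraph] at hv
    rw [← c.toSubgraph_rotate hv]
    exact (hc.rotate hv).connected_deleteVerts

/-- Since `a` is not a cut vertex, `b` and `b'` are joined by a path avoiding `a`, which the two
edges at `a` close up. -/
lemma Subgraph.IsTwoConnected.exists_isCycle {B : G.Subgraph} (hB : B.IsTwoConnected)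
    {a b b' : V} (hb : B.Adj a b) (hb' : B.Adj a b') (hne : b ≠ b') :
    ∃ c : G.Walk a a, c.IsCycle ∧ s(a, b) ∈ c.edges ∧ s(a, b') ∈ c.edges := by
  classical
  obtain ⟨-, hwalk⟩ := (Subgraph.connected_iff_forall_exists_walk_subgraph _).1
    (hB.no_cut_vertex a (B.edge_vert hb))
  obtain ⟨p, hp⟩ := hwalk (u := b) (v := b')
    ⟨B.edge_vert hb.symm, hb.ne.symm⟩ ⟨B.edge_vert hb'.symm, hb'.ne.symm⟩
  have ha : a ∉ p.bypass.support := fun ha =>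
    (hp.1 ((Walk.mem_verts_toSubgraph p).2 (p.support_bypass_subset_support ha))).2 rfl
  refine ⟨Walk.cons hb.adj_sub (p.bypass.concat hb'.adj_sub.symm), ?_, by simp, ?_⟩
  · rw [Walk.cons_isCycle_iff]
    refine ⟨p.bypass_isPath.concat ha _, ?_⟩
    rw [Walk.edges_concat, List.concat_eq_append, List.mem_append, List.mem_singleton,
      Sym2.eq_iff]
    rintro (h | ⟨h, -⟩ | ⟨-, h⟩)
    · exact ha (p.bypass.fst_mem_support_of_mem_edges h)
    · exact hb'.ne h
    · exact hne h
  · simp [Walk.edges_concat, Sym2.eq_swap]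

/-- In a cactus, a two-connected subgraph that shares an edge with a cycle is contained in it. -/
lemma IsCactus.le_toSubgraph (hG : G.IsCactus) {B : G.Subgraph} (hB : B.IsTwoConnected)
    {u x y : V} {c : G.Walk u u} (hc : c.IsCycle) (hxy : B.Adj x y) (hx : s(x, y) ∈ c.edges) :
    B ≤ c.toSubgraph := by
  -- Two edges of `B` at `a` lie on a common cycle, which is `c` as soon as one of them is on `c`.
  -- Connectedness of `B` then spreads this to all its edges.
  have step : ∀ a b b', B.Adj a b → c.toSubgraph.Adj a b → B.Adj a b' →
      c.toSubgraph.Adj a b' := by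
    intro a b b' hb hcb hb'
    by_cases hne : b = b'
    · exact hne ▸ hcb
    obtain ⟨d, hd, h1, h2⟩ := hB.exists_isCycle hb hb' hne
    rw [← Subgraph.mem_edgeSet, Walk.mem_edges_toSubgraph] at hcb ⊢
    rw [← Walk.mem_edges_toSubgraph, hG.toSubgraph_eq hb.ne hc hd hcb h1,
      Walk.mem_edges_toSubgraph]
    exact h2
  have walk : ∀ a b (p : G.Walk a b), p.toSubgraph ≤ B →
      (∃ w, B.Adj a w ∧ c.toSubgraph.Adj a w) → ∃ w, B.Adj b w ∧ c.toSubgraph.Adj b w := by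
    intro a b p
    induction p with
    | nil => exact fun _ h => h
    | @cons a v _ h p ih =>
      rintro hp ⟨w, hw, hcw⟩
      rw [Walk.toSubgraph, sup_le_iff] at hp
      have hB' : B.Adj a v := hp.1.2 (by simp)
      exact ih hp.2 ⟨_, hB'.symm, (step _ _ _ hw hcw hB').symm⟩
  have all : ∀ a ∈ B.verts, ∃ w, B.Adj a w ∧ c.toSubgraph.Adj a w := by
    intro a ha
    obtain ⟨p, hp⟩ := ((Subgraph.connected_iff_forall_exists_walk_subgraph _).1
      hB.connected).2 (B.edge_vert hxy) ha
    exact walk x a p hp ⟨y, hxy, by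
      rwa [← Subgraph.mem_edgeSet, Walk.mem_edges_toSubgraph]⟩
  refine ⟨fun a ha => ?_, fun a b hab => ?_⟩
  · obtain ⟨w, -, hw⟩ := all a ha
    exact c.toSubgraph.edge_vert hw
  · obtain ⟨w, hw, hcw⟩ := all a (B.edge_vert hab)
    exact step a w b hw hcw hab

lemma Subgraph.IsTwoConnected.exists_adj {B : G.Subgraph} (hB : B.IsTwoConnected) :
    ∃ x y, B.Adj x y := by
  have := hB.nontrivial.coe_sort
  obtain ⟨x, hx⟩ := hB.nontrivial.nonempty
  exact ⟨x, (hB.connected.preconnected.exists_adj_of_nontrivial ⟨x, hx⟩).imp fun _ h => h⟩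

lemma IsCactus.edgesOnEvenCycles_iff [Finite V] (hG : G.IsCactus) :
    G.EdgesOnEvenCycles ↔ ∀ B : G.Subgraph, B.IsBlock → B.IsEvenCycle := by
  constructor
  · intro hE B hB
    obtain ⟨x, y, hxy⟩ := hB.prop.exists_adj
    obtain ⟨u, c, hc, heven, hx⟩ := hE x y hxy.adj_sub
    exact ⟨c.length, heven, u, c, hc, rfl,
      (hB.eq_of_le hc.isTwoConnected (hG.le_toSubgraph hB.prop hc hxy hx)).symm⟩
  · intro h x y hxy
    obtain ⟨B, hle, hB⟩ := (Set.toFinite {K : G.Subgraph | K.IsTwoConnected}).exists_le_maximal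
      (Subgraph.isTwoConnected_subgraphOfAdj hxy)
    obtain ⟨n, hn, u, c, hc, rfl, rfl⟩ := h B hB
    refine ⟨u, c, hc, hn, ?_⟩
    rw [← Walk.mem_edges_toSubgraph, Subgraph.mem_edgeSet]
    exact hle.2 (by simp)

end Blocks

end SimpleGraph

theorem theorem3p1 {V : Type*} [Fintype V] [DecidableEq V] (G : SimpleGraph V)
    [Fintype G.edgeSet] (hG : G.IsCactus) :
    G.szegedIndex ≤ 2 * G.wienerIndex ∧
      (G.szegedIndex = 2 * G.wienerIndex ↔ ∀ B : G.Subgraph, B.IsBlock → B.IsEvenCycle) :=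
  ⟨hG.szegedIndex_le,
    hG.szegedIndex_eq_iff_edgesOnEvenCycles.trans hG.edgesOnEvenCycles_iff⟩
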